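/- **Setting.** Let $\rho$ be a probability measure on $\mathcal X\times\mathbb R$ ($\mathcal X$ a measurable space) with first marginal $\nu$, let $\mathcal H_1$ be a real separable Hilbert space, and let $A:\mathcal H_1\to L^2(\mathcal X,\nu)$ be a bounded linear operator of the form $(Af)(x)=\langle f,\phi_x\rangle$ for $\nu$-almost every $x$, where $\phi_x\in\mathcal H_1$ and, for some constant $c$, $|\langle f,\phi_x\rangle|\le c\|f\|$ for all $x\in\mathcal X$, $f\in\mathcal H_1$. Put $B=A^*A$; it is a compact positive operator, and $h(B)$ denotes the functional calculus of $B$. Let $(X_1,Y_1),\dots,(X_n,Y_n)$ be i.i.d. with law $\rho$ and write $\mathbb E$ for the expectation with respect to $\rho^{\otimes n}$. Assume that for $\nu$-almost every $x$ the conditional law of $Y$ given $X=x$ has finite second moment and $$\mathbb E(Y\mid X=x)=(Af^\dagger)(x),\qquad \mathrm{Var}(Y\mid X=x)=\sigma^2,$$ with $f^\dagger\in\mathcal H_1$ and a constant $\sigma$. Let $(s_\lambda)_{\lambda>0}$ be real functions on the spectrum $\sigma(B)$ for which there are constants $D,E,q>0$ and $C_p>0$ $(0\le p\le q)$ such that for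 all $\lambda>0$ and all $t\in\sigma(B)$ $$|t\,s_\lambda(t)|\le D,\qquad |\lambda\, s_\lambda(t)|\le E,\qquad |t^{p}(1-t\,s_\lambda(t))|\le C_{p}\lambda^{p}\quad(0\le p\le q).$$ Define the estimator $$\hat f_n^\lambda=s_\lambda(A^*A)A_{\mathbf x}^*\mathbf y,\qquad A_{\mathbf x}^*\mathbf y=\frac1n\sum_{j=1}^nY_j\phi_{X_j}.$$ **Lemma.** Assume the source condition $f^\dagger=B^rw$ with $\|w\|\le R$, where $0<r\le q$ and $R>0$, and the eigenvalue decay $\mu_j\le d\,j^{-b}$ for all $j\ge1$, where $d>0$, $b>1$ and $(\mu_j)_{j\ge1}$ lists the nonzero eigenvalues of $B$ with multiplicity (entries $\mu_j=0$ being allowed). Let $\lambda=\lambda_n>0$ with $\lambda_n=\Theta\big(n^{-1/(2r+1+1/b)}\big)$ as $n\to\infty$. Then $\mathbb E\|\hat f_n^{\lambda_n}-f^\dagger\|^2$ is finite for every $n$ and $$\mathbb E\big\|\hat f_n^{\lambda_n}-f^\dagger\big\|^2=O\Big(n^{-\frac{2r}{2r+1+1/b}}\Big)\qquad(n\to\infty).$$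 -/

import Mathlib

open MeasureTheory ProbabilityTheory Filter Asymptotics

noncomputable section

namespace SpectralRate

/-- The eigenspace `{v | T v = t v}` of a bounded operator (trivial when `t` is not an
eigenvalue). -/
abbrev eigSpace {H : Type*} [NormedAddCommGroup H] [InnerProductSpace ℝ H]
    (T : H →L[ℝ] H) (t : ℝ) : Submodule ℝ H :=
  Module.End.eigenspace (T : H →ₗ[ℝ] H) t

instance eigSpace_complete {H : Type*} [NormedAddCommGroup H] [InnerProductSpace ℝ H]
    [CompleteSpace H] (T : H →L[ℝ] H) (t : ℝ) : CompleteSpace (eigSpace T t) := by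
  have h : IsClosed {v : H | T v = t • v} :=
    isClosed_eq T.continuous (continuous_const_smul t)
  have h' : ((eigSpace T t : Submodule ℝ H) : Set H) = {v : H | T v = t • v} := by
    ext v
    simp [eigSpace, Module.End.mem_eigenspace_iff]
  exact IsClosed.completeSpace_coe (hs := h' ▸ h)

/-- Functional calculus `h(T)` of a compact self-adjoint operator `T`: the spectral sum
`h(T) v = ∑ h(t) P_t v` over the eigenvalues `t` of `T` (zero included), where `P_t` is the
orthogonal projection onto the eigenspace of `t`, so `P_t = 0` when `t` is not an eigenvalue.
The sum converges unconditionally for every `h` that is bounded on the spectrum of `T`. -/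
def spectralFun {H : Type*} [NormedAddCommGroup H] [InnerProductSpace ℝ H] [CompleteSpace H]
    (h : ℝ → ℝ) (T : H →L[ℝ] H) (v : H) : H :=
  ∑' t : ℝ, h t • (eigSpace T t).starProjection v

/-- `ev` lists the nonzero eigenvalues of `T`, each repeated according to its multiplicity;
entries equal to zero may occur, in particular when `T` has finite rank. -/
def IsEigenvalueList {H : Type*} [NormedAddCommGroup H] [InnerProductSpace ℝ H]
    (T : H →L[ℝ] H) (ev : ℕ → ℝ) : Prop :=
  ∀ t : ℝ, t ≠ 0 → {j | ev j = t}.encard = Cardinal.toENat (Module.rank ℝ (eigSpace T t))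

/-- The source set `ω(r, R) = {T^r w : ‖w‖ ≤ R}`. -/
def sourceSet {H : Type*} [NormedAddCommGroup H] [InnerProductSpace ℝ H] [CompleteSpace H]
    (T : H →L[ℝ] H) (r R : ℝ) : Set H :=
  {f | ∃ w : H, ‖w‖ ≤ R ∧ f = spectralFun (fun t => t ^ r) T w}

/-- `s = (s_l)_{l > 0}` is a family of regularization (filter) functions on the spectrum of `T`
with qualification `q`. -/
structure IsFilterFamily {H : Type*} [NormedAddCommGroup H] [InnerProductSpace ℝ H]
    (T : H →L[ℝ] H) (s : ℝ → ℝ → ℝ) (q : ℝ) : Prop where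
  qualification_pos : 0 < q
  bound_mul : ∃ D > 0, ∀ l > 0, ∀ t ∈ spectrum ℝ T, |t * s l t| ≤ D
  bound_param : ∃ E > 0, ∀ l > 0, ∀ t ∈ spectrum ℝ T, |l * s l t| ≤ E
  qualification : ∀ p : ℝ, 0 ≤ p → p ≤ q → ∃ C > 0, ∀ l > 0, ∀ t ∈ spectrum ℝ T,
    |t ^ p * (1 - t * s l t)| ≤ C * l ^ p

/-- The sampling model: under `ρ`, the conditional law of `Y` given `X = x` has finite second
moment, mean `y x` and variance `σ ^ 2`, for almost every `x` with respect to the law of `X`. -/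
structure IsSamplingModel {X : Type*} [MeasurableSpace X] (ρ : Measure (X × ℝ))
    [IsFiniteMeasure ρ] (y : X → ℝ) (σ : ℝ) : Prop where
  memLp_two : ∀ᵐ x ∂ρ.fst, MemLp (fun u : ℝ => u) 2 (ρ.condKernel x)
  cond_mean : ∀ᵐ x ∂ρ.fst, ∫ u, u ∂(ρ.condKernel x) = y x
  cond_variance : ∀ᵐ x ∂ρ.fst, variance (fun u : ℝ => u) (ρ.condKernel x) = σ ^ 2

/-- `A_x^* y = (1/n) ∑ Y_j φ_{X_j}` for the sample `z = ((X_1, Y_1), …, (X_n, Y_n))`: the adjoint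
of `f ↦ (⟨f, φ_{X_j}⟩)_j` when `ℝ^n` carries the inner product `(1/n) ∑ a_j b_j`. -/
def sampleAdjoint {X H : Type*} [NormedAddCommGroup H] [InnerProductSpace ℝ H]
    (φ : X → H) {n : ℕ} (z : Fin n → X × ℝ) : H :=
  (1 / (n : ℝ)) • ∑ j, (z j).2 • φ (z j).1

/-- The estimator `s_l(B) A_x^* y`, with `B = A^* A` the population operator. -/
def estimator {X H : Type*} [NormedAddCommGroup H] [InnerProductSpace ℝ H] [CompleteSpace H]
    (B : H →L[ℝ] H) (s : ℝ → ℝ → ℝ) (φ : X → H) (l : ℝ) {n : ℕ} (z : Fin n → X × ℝ) : H :=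
  spectralFun (s l) B (sampleAdjoint φ z)

/-- `B = A^* A`. -/
def normalOp {H K : Type*} [NormedAddCommGroup H] [InnerProductSpace ℝ H] [CompleteSpace H]
    [NormedAddCommGroup K] [InnerProductSpace ℝ K] [CompleteSpace K] (A : H →L[ℝ] K) :
    H →L[ℝ] H :=
  (ContinuousLinearMap.adjoint A).comp A

end SpectralRate

end

/-!
The risk splits into squared bias and variance. By the source condition `f† = B^r w` the bias is
`t^r (1 - t s_λ(t))` applied to `w`, hence `O(λ^r)` by the qualification. As `f ↦ ⟨f, φ_X⟩`
represents `A`, the second moment `E⟨v, φ_X⟩²` is `⟨v, B v⟩`, so the variance is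
`O(n⁻¹ tr(s_λ(B)² B)) = O(n⁻¹ ∑ s_λ(μ_j)² μ_j)`. On the spectrum
`s_λ(t)² t ≤ (D E / λ) min(1, (E / D) t / λ)`, and comparing `∑ min(1, u j^{-b}) = O(u^{1/b})` with
an integral gives the variance `O(n⁻¹ λ^{-(1 + 1/b)})`. The prescribed `λ_n` balances the two terms.
-/

namespace SpectralRate

open Module.End (HasEigenvalue mem_eigenspace_iff)
open scoped ENNReal InnerProductSpace

section Hilbert

variable {H : Type*} [NormedAddCommGroup H] [InnerProductSpace ℝ H]

theorem enorm_sq_eq_ofReal {E : Type*} [SeminormedAddGroup E] (x : E) :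
    ‖x‖ₑ ^ 2 = ENNReal.ofReal (‖x‖ ^ 2) := by
  rw [ENNReal.ofReal_pow (norm_nonneg x), ofReal_norm]

theorem countable_of_orthonormal [TopologicalSpace.SeparableSpace H] {ι : Type*} {v : ι → H}
    (hv : Orthonormal ℝ v) : Countable ι := by
  rw [← Set.countable_univ_iff]
  refine Set.PairwiseDisjoint.countable_of_isOpen (s := fun i => Metric.ball (v i) (1 / 2)) ?_
    (fun _ _ => Metric.isOpen_ball) (fun i _ => ⟨v i, by simp⟩)
  intro i _ j _ hij
  refine Metric.ball_disjoint_ball ?_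
  have dist_sq : dist (v i) (v j) ^ 2 = 2 := by
    rw [dist_eq_norm, norm_sub_sq_real, hv.1 i, hv.1 j, hv.2 hij]
    norm_num
  nlinarith [dist_nonneg (x := v i) (y := v j)]

theorem enorm_sq_eq_tsum_enorm_sq_inner {ι : Type*} (b : HilbertBasis ι ℝ H) (x : H) :
    ‖x‖ₑ ^ 2 = ∑' i, ‖⟪b i, x⟫_ℝ‖ₑ ^ 2 := by
  have parseval : HasSum (fun i => ‖⟪b i, x⟫_ℝ‖ ^ 2) (‖x‖ ^ 2) := by
    simpa only [real_inner_self_eq_norm_sq, real_inner_comm x, ← sq, Real.norm_eq_abs, sq_abs]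
      using b.hasSum_inner_mul_inner x x
  simp_rw [enorm_sq_eq_ofReal]
  rw [← parseval.tsum_eq, ENNReal.ofReal_tsum_of_nonneg (fun _ => sq_nonneg _) parseval.summable]

theorem norm_le_abs_of_forall_abs_inner_le {x : H} {c : ℝ} (h : ∀ f : H, |⟪f, x⟫_ℝ| ≤ c * ‖f‖) :
    ‖x‖ ≤ |c| := by
  have h_self : ‖x‖ ^ 2 ≤ c * ‖x‖ := by simpa [real_inner_self_eq_norm_sq] using h x
  nlinarith [le_abs_self c, abs_nonneg c, norm_nonneg x]

end Hilbert

section Eigenspaces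

variable {H : Type*} [NormedAddCommGroup H] [InnerProductSpace ℝ H] {T : H →L[ℝ] H}

/-- `h` is bounded by `M` on the eigenvalues of `T`: the values of `h` elsewhere do not enter
`h(T)`. -/
def BoundedOnEigenvalues (T : H →L[ℝ] H) (h : ℝ → ℝ) (M : ℝ) : Prop :=
  ∀ t, HasEigenvalue (T : H →ₗ[ℝ] H) t → |h t| ≤ M

theorem mem_eigSpace_iff {t : ℝ} {v : H} : v ∈ eigSpace T t ↔ T v = t • v :=
  mem_eigenspace_iff

theorem IsEigenvalueList.hasEigenvalue_iff_mem_range {ev : ℕ → ℝ} (hev : IsEigenvalueList T ev)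
    {t : ℝ} (ht : t ≠ 0) : HasEigenvalue (T : H →ₗ[ℝ] H) t ↔ t ∈ Set.range ev := by
  have h_mult := hev t ht
  rw [← not_iff_not, Module.End.hasEigenvalue_iff, not_not, ← Submodule.rank_eq_zero,
    ← Cardinal.toENat_eq_zero, ← h_mult, Set.encard_eq_zero, ← Set.preimage_singleton_eq_empty]
  rfl

theorem countable_hasEigenvalue [TopologicalSpace.SeparableSpace H]
    (hT : (T : H →ₗ[ℝ] H).IsSymmetric) : {t | HasEigenvalue (T : H →ₗ[ℝ] H) t}.Countable := by
  have exists_unit : ∀ t : {t | HasEigenvalue (T : H →ₗ[ℝ] H) t},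
      ∃ v : eigSpace T t, ‖v‖ = 1 := fun t =>
    have : Nontrivial (eigSpace T t) := Submodule.nontrivial_iff_ne_bot.2 t.2
    exists_norm_eq _ zero_le_one
  choose v hv using exists_unit
  refine (countable_of_orthonormal (v := fun t => (v t : H)) ⟨hv, fun t t' htt' => ?_⟩).to_set
  exact hT.orthogonalFamily_eigenspaces (Subtype.coe_ne_coe.2 htt') (v t) (v t')

variable [CompleteSpace H]

theorem mem_spectrum_of_hasEigenvalue {t : ℝ} (ht : HasEigenvalue (T : H →ₗ[ℝ] H) t) :
    t ∈ spectrum ℝ T := by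
  rw [ContinuousLinearMap.spectrum_eq]
  exact ht.mem_spectrum

theorem abs_le_norm_of_hasEigenvalue {t : ℝ} (ht : HasEigenvalue (T : H →ₗ[ℝ] H) t) :
    |t| ≤ ‖T‖ :=
  (spectrum.norm_le_norm_mul_of_mem (mem_spectrum_of_hasEigenvalue ht)).trans
    (mul_le_of_le_one_right (norm_nonneg T) ContinuousLinearMap.norm_id_le)

theorem starProjection_eq_zero_of_not_hasEigenvalue {t : ℝ}
    (ht : ¬HasEigenvalue (T : H →ₗ[ℝ] H) t) (v : H) : (eigSpace T t).starProjection v = 0 := by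
  have h_bot : eigSpace T t = ⊥ := not_not.1 ht
  exact (Submodule.eq_bot_iff _).1 h_bot _ (Submodule.starProjection_apply_mem _ v)

theorem starProjection_apply_eq_smul (hT : (T : H →ₗ[ℝ] H).IsSymmetric) (v : H) (t : ℝ) :
    (eigSpace T t).starProjection (T v) = t • (eigSpace T t).starProjection v := by
  refine Submodule.eq_starProjection_of_mem_of_inner_eq_zero
    (Submodule.smul_mem _ _ (Submodule.starProjection_apply_mem _ v)) fun w hw => ?_
  have h_symm : ⟪T v, w⟫_ℝ = ⟪v, T w⟫_ℝ := hT v w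
  rw [inner_sub_left, h_symm, mem_eigSpace_iff.1 hw, inner_smul_left, inner_smul_right]
  simp [← mul_sub, ← inner_sub_left, Submodule.starProjection_inner_eq_zero v w hw]

theorem norm_sq_sum_smul_starProjection (hT : (T : H →ₗ[ℝ] H).IsSymmetric) (h : ℝ → ℝ) (v : H)
    (F : Finset ℝ) : ‖∑ t ∈ F, h t • (eigSpace T t).starProjection v‖ ^ 2
      = ∑ t ∈ F, h t ^ 2 * ‖(eigSpace T t).starProjection v‖ ^ 2 := by
  simpa [norm_smul, mul_pow] using hT.orthogonalFamily_eigenspaces.norm_sum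
    (fun t => h t • (eigSpace T t).orthogonalProjectionOnto v) F

theorem sum_norm_sq_starProjection_le (hT : (T : H →ₗ[ℝ] H).IsSymmetric) (v : H) (F : Finset ℝ) :
    ∑ t ∈ F, ‖(eigSpace T t).starProjection v‖ ^ 2 ≤ ‖v‖ ^ 2 := by
  set S := ∑ t ∈ F, (eigSpace T t).starProjection v with hS
  have norm_sq_S : ‖S‖ ^ 2 = ∑ t ∈ F, ‖(eigSpace T t).starProjection v‖ ^ 2 := by
    simpa using norm_sq_sum_smul_starProjection hT 1 v F
  have inner_S : ⟪v, S⟫_ℝ = ∑ t ∈ F, ‖(eigSpace T t).starProjection v‖ ^ 2 := by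
    rw [hS, inner_sum]
    refine Finset.sum_congr rfl fun t _ => ?_
    rw [real_inner_comm]
    exact (eigSpace T t).re_inner_starProjection_eq_normSq v
  have h_nonneg := sq_nonneg ‖v - S‖
  rw [norm_sub_sq_real, inner_S, norm_sq_S] at h_nonneg
  linarith

end Eigenspaces

section FunctionalCalculus

variable {H : Type*} [NormedAddCommGroup H] [InnerProductSpace ℝ H] [CompleteSpace H]
  {T : H →L[ℝ] H} {h : ℝ → ℝ} {M : ℝ}

theorem sq_mul_norm_sq_starProjection_le (hM : BoundedOnEigenvalues T h M) (v : H) (t : ℝ) :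
    h t ^ 2 * ‖(eigSpace T t).starProjection v‖ ^ 2
      ≤ M ^ 2 * ‖(eigSpace T t).starProjection v‖ ^ 2 := by
  by_cases ht : HasEigenvalue (T : H →ₗ[ℝ] H) t
  · gcongr ?_ * _
    exact sq_le_sq.2 ((hM t ht).trans (le_abs_self M))
  · simp [starProjection_eq_zero_of_not_hasEigenvalue ht]

theorem summable_smul_starProjection (hT : (T : H →ₗ[ℝ] H).IsSymmetric)
    (hM : BoundedOnEigenvalues T h M) (v : H) :
    Summable fun t => h t • (eigSpace T t).starProjection v := by
  have summable_bessel : Summable fun t => ‖(eigSpace T t).starProjection v‖ ^ 2 :=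
    summable_of_sum_le (fun _ => sq_nonneg _) (sum_norm_sq_starProjection_le hT v)
  have summable_sq : Summable fun t => h t ^ 2 * ‖(eigSpace T t).starProjection v‖ ^ 2 :=
    (summable_bessel.mul_left (M ^ 2)).of_nonneg_of_le (fun _ => by positivity)
      (sq_mul_norm_sq_starProjection_le hM v)
  refine (hT.orthogonalFamily_eigenspaces.summable_iff_norm_sq_summable
    fun t => h t • (eigSpace T t).orthogonalProjectionOnto v).2 ?_
  simpa [norm_smul, mul_pow] using summable_sq

theorem hasSum_norm_sq_spectralFun (hT : (T : H →ₗ[ℝ] H).IsSymmetric)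
    (hM : BoundedOnEigenvalues T h M) (v : H) :
    HasSum (fun t => h t ^ 2 * ‖(eigSpace T t).starProjection v‖ ^ 2)
      (‖spectralFun h T v‖ ^ 2) := by
  have h_lim := (summable_smul_starProjection hT hM v).hasSum.norm.pow 2
  exact h_lim.congr fun F => norm_sq_sum_smul_starProjection hT h v F

theorem enorm_sq_spectralFun (hT : (T : H →ₗ[ℝ] H).IsSymmetric)
    (hM : BoundedOnEigenvalues T h M) (v : H) : ‖spectralFun h T v‖ₑ ^ 2
      = ∑' t, ENNReal.ofReal (h t ^ 2) * ‖(eigSpace T t).starProjection v‖ₑ ^ 2 := by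
  have h_sum := hasSum_norm_sq_spectralFun hT hM v
  rw [enorm_sq_eq_ofReal, ← h_sum.tsum_eq,
    ENNReal.ofReal_tsum_of_nonneg (fun _ => by positivity) h_sum.summable]
  simp_rw [enorm_sq_eq_ofReal, ENNReal.ofReal_mul (sq_nonneg _)]

theorem norm_spectralFun_le (hT : (T : H →ₗ[ℝ] H).IsSymmetric) (hM0 : 0 ≤ M)
    (hM : BoundedOnEigenvalues T h M) (v : H) : ‖spectralFun h T v‖ ≤ M * ‖v‖ := by
  refine (sq_le_sq₀ (norm_nonneg _) (by positivity)).1 ?_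
  refine hasSum_le_of_sum_le (hasSum_norm_sq_spectralFun hT hM v) fun F => ?_
  calc ∑ t ∈ F, h t ^ 2 * ‖(eigSpace T t).starProjection v‖ ^ 2
      ≤ ∑ t ∈ F, M ^ 2 * ‖(eigSpace T t).starProjection v‖ ^ 2 :=
        Finset.sum_le_sum fun t _ => sq_mul_norm_sq_starProjection_le hM v t
    _ = M ^ 2 * ∑ t ∈ F, ‖(eigSpace T t).starProjection v‖ ^ 2 := (Finset.mul_sum ..).symm
    _ ≤ M ^ 2 * ‖v‖ ^ 2 := by gcongr; exact sum_norm_sq_starProjection_le hT v F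
    _ = (M * ‖v‖) ^ 2 := (mul_pow ..).symm

theorem isBoundedLinearMap_spectralFun (hT : (T : H →ₗ[ℝ] H).IsSymmetric)
    (hM : BoundedOnEigenvalues T h M) : IsBoundedLinearMap ℝ (spectralFun h T) := by
  have isLinearMap : IsLinearMap ℝ (spectralFun h T) :=
    { map_add := fun v w => by
        simp only [spectralFun, map_add, smul_add]
        exact (summable_smul_starProjection hT hM v).tsum_add (summable_smul_starProjection hT hM w)
      map_smul := fun a v => by
        simp only [spectralFun, map_smul, smul_comm _ a]
        exact (summable_smul_starProjection hT hM v).tsum_const_smul a }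
  exact isLinearMap.with_bound |M| (norm_spectralFun_le hT (abs_nonneg M)
    fun t ht => (hM t ht).trans (le_abs_self M))

theorem starProjection_spectralFun (hT : (T : H →ₗ[ℝ] H).IsSymmetric)
    (hM : BoundedOnEigenvalues T h M) (v : H) (t : ℝ) :
    (eigSpace T t).starProjection (spectralFun h T v) = h t • (eigSpace T t).starProjection v := by
  rw [spectralFun, ContinuousLinearMap.map_tsum _ (summable_smul_starProjection hT hM v),
    tsum_eq_single t]
  · rw [map_smul, Submodule.starProjection_eq_self_iff.2 (Submodule.starProjection_apply_mem _ v)]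
  · intro t' ht'
    have h_orth : (eigSpace T t').starProjection v ∈ (eigSpace T t)ᗮ :=
      (hT.orthogonalFamily_eigenspaces.isOrtho ht'.symm).ge
        (Submodule.starProjection_apply_mem _ v)
    rw [map_smul, (Submodule.starProjection_apply_eq_zero_iff _).2 h_orth, smul_zero]

theorem spectralFun_apply_sub_eq_spectralFun_residual (hT : (T : H →ₗ[ℝ] H).IsSymmetric)
    {k : ℝ → ℝ} {N : ℝ} (hM : BoundedOnEigenvalues T h M) (hN : BoundedOnEigenvalues T k N)
    (w : H) : spectralFun h T (T (spectralFun k T w)) - spectralFun k T w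
      = spectralFun (fun t => -(k t * (1 - t * h t))) T w := by
  have h_sub := (summable_smul_starProjection hT hM (T (spectralFun k T w))).tsum_sub
    (summable_smul_starProjection hT hN w)
  refine h_sub.symm.trans (tsum_congr fun t => ?_)
  rw [starProjection_apply_eq_smul hT, starProjection_spectralFun hT hN]
  module

theorem norm_spectralFun_apply_sub_le (hT : (T : H →ₗ[ℝ] H).IsSymmetric) {k : ℝ → ℝ} {N C : ℝ}
    (hM : BoundedOnEigenvalues T h M) (hN : BoundedOnEigenvalues T k N) (hC0 : 0 ≤ C)
    (hC : BoundedOnEigenvalues T (fun t => k t * (1 - t * h t)) C) (w : H) :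
    ‖spectralFun h T (T (spectralFun k T w)) - spectralFun k T w‖ ≤ C * ‖w‖ := by
  rw [spectralFun_apply_sub_eq_spectralFun_residual hT hM hN]
  exact norm_spectralFun_le hT hC0 (fun t ht => by simpa only [abs_neg] using hC t ht) w

end FunctionalCalculus

section SecondMoments

variable {Ω : Type*} [MeasurableSpace Ω] {μ : Measure Ω}

theorem lintegral_enorm_sq_eq_ofReal_integral {E : Type*} [NormedAddCommGroup E] {f : Ω → E}
    (hf : MemLp f 2 μ) : ∫⁻ x, ‖f x‖ₑ ^ 2 ∂μ = ENNReal.ofReal (∫ x, ‖f x‖ ^ 2 ∂μ) := by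
  rw [ofReal_integral_eq_lintegral_ofReal (hf.integrable_norm_pow two_ne_zero)
    (ae_of_all _ fun _ => sq_nonneg _)]
  simp_rw [enorm_sq_eq_ofReal]

variable {H : Type*} [NormedAddCommGroup H] [InnerProductSpace ℝ H]

theorem integrable_inner_of_memLp_two {f g : Ω → H} (hf : MemLp f 2 μ) (hg : MemLp g 2 μ) :
    Integrable (fun x => ⟪f x, g x⟫_ℝ) μ :=
  memLp_one_iff_integrable.1 ((innerSL ℝ).memLp_of_bilin 1 hf hg)

theorem integral_norm_sq_sum_of_pairwise_orthogonal {ι : Type*} {D : ι → Ω → H} {s : Finset ι}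
    (hD : ∀ i ∈ s, MemLp (D i) 2 μ)
    (h_orth : ∀ i ∈ s, ∀ j ∈ s, i ≠ j → ∫ x, ⟪D i x, D j x⟫_ℝ ∂μ = 0) :
    ∫ x, ‖∑ i ∈ s, D i x‖ ^ 2 ∂μ = ∑ i ∈ s, ∫ x, ‖D i x‖ ^ 2 ∂μ := by
  simp_rw [← real_inner_self_eq_norm_sq, sum_inner, inner_sum]
  rw [integral_finsetSum _ fun i hi => integrable_finsetSum _ fun j hj =>
    integrable_inner_of_memLp_two (hD i hi) (hD j hj)]
  refine Finset.sum_congr rfl fun i hi => ?_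
  rw [integral_finsetSum _ fun j hj => integrable_inner_of_memLp_two (hD i hi) (hD j hj)]
  exact Finset.sum_eq_single_of_mem i hi fun j hj hji => h_orth i hi j hj hji.symm

variable [CompleteSpace H]

theorem aestronglyMeasurable_of_inner [TopologicalSpace.SeparableSpace H] {ψ : Ω → H}
    (h : ∀ f : H, AEStronglyMeasurable (fun x => ⟪f, ψ x⟫_ℝ) μ) : AEStronglyMeasurable ψ μ := by
  obtain ⟨w, b, -⟩ := exists_hilbertBasis ℝ H
  have : Countable w := countable_of_orthonormal b.orthonormal
  refine aestronglyMeasurable_of_tendsto_ae (atTop : Filter (Finset w))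
    (f := fun F x => ∑ i ∈ F, ⟪b i, ψ x⟫_ℝ • b i)
    (fun F => Finset.aestronglyMeasurable_fun_sum F fun i _ => (h (b i)).smul_const (b i))
    (ae_of_all _ fun x => ?_)
  simpa only [b.repr_apply_apply] using! b.hasSum_repr (ψ x)

theorem integral_norm_sq_sub [IsProbabilityMeasure μ] {W : Ω → H} (hW : MemLp W 2 μ) (a : H) :
    ∫ x, ‖W x - a‖ ^ 2 ∂μ = ∫ x, ‖W x - ∫ y, W y ∂μ‖ ^ 2 ∂μ + ‖∫ y, W y ∂μ - a‖ ^ 2 := by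
  set m := ∫ y, W y ∂μ with hm
  have hWm : MemLp (fun x => W x - m) 2 μ := hW.sub (memLp_const m)
  have integral_centered : ∫ x, (W x - m) ∂μ = 0 := by
    rw [integral_sub (hW.integrable one_le_two) (integrable_const m)]
    simp [hm]
  have integral_cross : ∫ x, 2 * ⟪W x - m, m - a⟫_ℝ ∂μ = 0 := by
    simp_rw [real_inner_comm (m - a)]
    rw [integral_const_mul, integral_inner (hWm.integrable one_le_two), integral_centered]
    simp
  have h_expand : ∀ x, ‖W x - a‖ ^ 2
      = ‖W x - m‖ ^ 2 + 2 * ⟪W x - m, m - a⟫_ℝ + ‖m - a‖ ^ 2 := fun x => by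
    rw [← norm_add_sq_real, sub_add_sub_cancel]
  have integrable_cross : Integrable (fun x => 2 * ⟪W x - m, m - a⟫_ℝ) μ :=
    ((hWm.integrable one_le_two).inner_const (m - a)).const_mul 2
  have integrable_sq : Integrable (fun x => ‖W x - m‖ ^ 2) μ := hWm.integrable_norm_pow'
  simp_rw [h_expand]
  rw [integral_add (integrable_sq.fun_add integrable_cross) (integrable_const _),
    integral_add integrable_sq integrable_cross, integral_cross]
  simp

end SecondMoments

section EmpiricalMean

variable {Ω : Type*} [MeasurableSpace Ω] {μ : Measure Ω} [IsProbabilityMeasure μ]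
  {H : Type*} [NormedAddCommGroup H] [InnerProductSpace ℝ H] {n : ℕ}

/-- The empirical mean `(1/n) ∑ Z(ω_j)` of `Z` over a sample `ω = (ω_1, …, ω_n)`; it is `0` for
`n = 0`. -/
noncomputable def empiricalMean {Ω H : Type*} [NormedAddCommGroup H] [InnerProductSpace ℝ H]
    (Z : Ω → H) {n : ℕ} (ω : Fin n → Ω) : H :=
  (1 / (n : ℝ)) • ∑ j, Z (ω j)

theorem memLp_comp_eval {E : Type*} [NormedAddCommGroup E] {Z : Ω → E} (hZ : MemLp Z 2 μ)
    (j : Fin n) : MemLp (fun ω : Fin n → Ω => Z (ω j)) 2 (Measure.pi fun _ => μ) :=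
  hZ.comp_measurePreserving (measurePreserving_eval (fun _ => μ) j)

theorem memLp_empiricalMean {Z : Ω → H} (hZ : MemLp Z 2 μ) :
    MemLp (fun ω : Fin n → Ω => empiricalMean Z ω) 2 (Measure.pi fun _ => μ) :=
  (memLp_finsetSum _ fun j _ => memLp_comp_eval hZ j).const_smul _

theorem integral_empiricalMean {Z : Ω → H} (hZ : MemLp Z 2 μ) (hn : n ≠ 0) :
    ∫ ω : Fin n → Ω, empiricalMean Z ω ∂(Measure.pi fun _ => μ) = ∫ x, Z x ∂μ := by
  simp_rw [empiricalMean]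
  rw [integral_smul, integral_finsetSum _ fun j _ => (memLp_comp_eval hZ j).integrable one_le_two]
  simp_rw [integral_comp_eval (μ := fun _ : Fin n => μ) hZ.1]
  rw [Finset.sum_const, Finset.card_univ, Fintype.card_fin, ← Nat.cast_smul_eq_nsmul ℝ, smul_smul,
    one_div_mul_cancel (Nat.cast_ne_zero.2 hn), one_smul]

variable [CompleteSpace H]

theorem integral_inner_comp_eval_of_ne {Z : Ω → H} (hZ : MemLp Z 2 μ) {i j : Fin n} (hij : i ≠ j) :
    ∫ ω : Fin n → Ω, ⟪Z (ω i), Z (ω j)⟫_ℝ ∂(Measure.pi fun _ => μ)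
      = ⟪∫ x, Z x ∂μ, ∫ x, Z x ∂μ⟫_ℝ := by
  borelize H
  have h_indep := (iIndepFun_pi fun _ : Fin n => hZ.1.aemeasurable).indepFun hij
  have integral_eq := h_indep.integral_bilin ((memLp_comp_eval hZ i).integrable one_le_two)
    ((memLp_comp_eval hZ j).integrable one_le_two) (innerSL ℝ)
  rw [integral_comp_eval (μ := fun _ => μ) hZ.1, integral_comp_eval (μ := fun _ => μ) hZ.1]
    at integral_eq
  exact integral_eq

theorem integral_norm_sq_empiricalMean_of_integral_eq_zero {Z : Ω → H} (hZ : MemLp Z 2 μ)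
    (h_zero : ∫ x, Z x ∂μ = 0) :
    ∫ ω : Fin n → Ω, ‖empiricalMean Z ω‖ ^ 2 ∂(Measure.pi fun _ => μ)
      = 1 / n * ∫ x, ‖Z x‖ ^ 2 ∂μ := by
  have integral_sum : ∫ ω : Fin n → Ω, ‖∑ j, Z (ω j)‖ ^ 2 ∂(Measure.pi fun _ => μ)
      = n * ∫ x, ‖Z x‖ ^ 2 ∂μ := by
    rw [integral_norm_sq_sum_of_pairwise_orthogonal (fun j _ => memLp_comp_eval hZ j)
      fun i _ j _ hij => by
        rw [integral_inner_comp_eval_of_ne hZ hij, h_zero, inner_zero_left]]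
    have integral_sq : ∀ j : Fin n, ∫ ω : Fin n → Ω, ‖Z (ω j)‖ ^ 2 ∂(Measure.pi fun _ => μ)
        = ∫ x, ‖Z x‖ ^ 2 ∂μ := fun j =>
      integral_comp_eval (μ := fun _ => μ) (f := fun x => ‖Z x‖ ^ 2) (hZ.1.norm.pow 2)
    simp [integral_sq]
  simp_rw [empiricalMean, norm_smul, mul_pow]
  rw [integral_const_mul, integral_sum]
  rcases eq_or_ne n 0 with rfl | hn
  · simp
  · simp only [Real.norm_eq_abs, sq_abs]
    field_simp

theorem integral_norm_sq_empiricalMean_sub {Z : Ω → H} (hZ : MemLp Z 2 μ) (hn : n ≠ 0) (a : H) :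
    ∫ ω : Fin n → Ω, ‖empiricalMean Z ω - a‖ ^ 2 ∂(Measure.pi fun _ => μ)
      = 1 / n * ∫ x, ‖Z x - ∫ y, Z y ∂μ‖ ^ 2 ∂μ + ‖∫ y, Z y ∂μ - a‖ ^ 2 := by
  set m := ∫ y, Z y ∂μ with hm
  have empiricalMean_centered : ∀ ω : Fin n → Ω,
      empiricalMean Z ω - m = empiricalMean (fun x => Z x - m) ω := fun ω => by
    rw [empiricalMean, empiricalMean, Finset.sum_sub_distrib, smul_sub, Finset.sum_const,
      Finset.card_univ, Fintype.card_fin, ← Nat.cast_smul_eq_nsmul ℝ, smul_smul,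
      one_div_mul_cancel (Nat.cast_ne_zero.2 hn), one_smul]
  have integral_centered : ∫ x, (Z x - m) ∂μ = 0 := by
    rw [integral_sub (hZ.integrable one_le_two) (integrable_const m)]
    simp [hm]
  rw [integral_norm_sq_sub (memLp_empiricalMean hZ), integral_empiricalMean hZ hn]
  simp_rw [← hm, empiricalMean_centered]
  have memLp_centered : MemLp (fun x => Z x - m) 2 μ := hZ.sub (memLp_const m)
  rw [integral_norm_sq_empiricalMean_of_integral_eq_zero memLp_centered integral_centered]

theorem integral_norm_sq_empiricalMean_sub_le {Z : Ω → H} (hZ : MemLp Z 2 μ) (hn : n ≠ 0) (a : H) :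
    ∫ ω : Fin n → Ω, ‖empiricalMean Z ω - a‖ ^ 2 ∂(Measure.pi fun _ => μ)
      ≤ 1 / n * ∫ x, ‖Z x‖ ^ 2 ∂μ + ‖∫ y, Z y ∂μ - a‖ ^ 2 := by
  have variance_le : ∫ x, ‖Z x - ∫ y, Z y ∂μ‖ ^ 2 ∂μ ≤ ∫ x, ‖Z x‖ ^ 2 ∂μ := by
    have h_zero := integral_norm_sq_sub hZ 0
    simp only [sub_zero] at h_zero
    linarith [sq_nonneg ‖∫ y, Z y ∂μ‖]
  rw [integral_norm_sq_empiricalMean_sub hZ hn]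
  gcongr

end EmpiricalMean

section NormalOperator

variable {H K : Type*} [NormedAddCommGroup H] [InnerProductSpace ℝ H] [CompleteSpace H]
  [NormedAddCommGroup K] [InnerProductSpace ℝ K] [CompleteSpace K] {A : H →L[ℝ] K}

theorem inner_normalOp_right (f g : H) : ⟪f, normalOp A g⟫_ℝ = ⟪A f, A g⟫_ℝ :=
  ContinuousLinearMap.adjoint_inner_right A f (A g)

theorem isSymmetric_normalOp : (normalOp A : H →ₗ[ℝ] H).IsSymmetric :=
  (ContinuousLinearMap.isPositive_adjoint_comp_self A).isSymmetric

theorem norm_sq_apply_of_mem_eigSpace_normalOp {t : ℝ} {v : H}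
    (hv : v ∈ eigSpace (normalOp A) t) : ‖A v‖ ^ 2 = t * ‖v‖ ^ 2 := by
  rw [← real_inner_self_eq_norm_sq, ← inner_normalOp_right, mem_eigSpace_iff.1 hv,
    inner_smul_right, real_inner_self_eq_norm_sq]

theorem nonneg_of_hasEigenvalue_normalOp {t : ℝ}
    (ht : HasEigenvalue (normalOp A : H →ₗ[ℝ] H) t) : 0 ≤ t := by
  obtain ⟨v, hv, hv0⟩ := ht.exists_hasEigenvector
  have h_mul : 0 ≤ t * ‖v‖ ^ 2 :=
    norm_sq_apply_of_mem_eigSpace_normalOp (A := A) hv ▸ sq_nonneg ‖A v‖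
  exact nonneg_of_mul_nonneg_left h_mul (by positivity)

end NormalOperator

section RandomVectors

variable {X : Type*} [MeasurableSpace X] {ν : Measure X}
  {H : Type*} [NormedAddCommGroup H] [InnerProductSpace ℝ H] [CompleteSpace H]
  [TopologicalSpace.SeparableSpace H] {T : H →L[ℝ] H}

theorem lintegral_enorm_sq_starProjection (V : Submodule ℝ H) [CompleteSpace V]
    {ι : Type*} (b : HilbertBasis ι ℝ V) {ψ : X → H} (hψ : AEStronglyMeasurable ψ ν) :
    ∫⁻ x, ‖V.starProjection (ψ x)‖ₑ ^ 2 ∂ν = ∑' i, ∫⁻ x, ‖⟪(b i : H), ψ x⟫_ℝ‖ₑ ^ 2 ∂ν := by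
  have : Countable ι := countable_of_orthonormal b.orthonormal
  have parseval : ∀ x, ‖V.starProjection (ψ x)‖ₑ ^ 2 = ∑' i, ‖⟪(b i : H), ψ x⟫_ℝ‖ₑ ^ 2 := by
    intro x
    have h_basis := enorm_sq_eq_tsum_enorm_sq_inner b (V.orthogonalProjectionOnto (ψ x))
    simp only [Submodule.inner_orthogonalProjectionOnto_eq_of_mem_left] at h_basis
    exact h_basis
  simp_rw [parseval]
  exact lintegral_tsum fun i => (hψ.const_inner (c := (b i : H))).enorm.pow_const 2

theorem lintegral_enorm_sq_spectralFun (hT : (T : H →ₗ[ℝ] H).IsSymmetric) {h : ℝ → ℝ} {M : ℝ}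
    (hM : BoundedOnEigenvalues T h M) {ψ : X → H} (hψ : AEStronglyMeasurable ψ ν) :
    ∫⁻ x, ‖spectralFun h T (ψ x)‖ₑ ^ 2 ∂ν = ∑' t, ENNReal.ofReal (h t ^ 2)
      * ∫⁻ x, ‖(eigSpace T t).starProjection (ψ x)‖ₑ ^ 2 ∂ν := by
  set S := {t | HasEigenvalue (T : H →ₗ[ℝ] H) t}
  have : Countable S := (countable_hasEigenvalue hT).to_subtype
  have tsum_eq_tsum_subtype : ∀ F : ℝ → ℝ≥0∞, (∀ t ∉ S, F t = 0) →
      ∑' t, F t = ∑' t : S, F t := fun F hF =>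
    (tsum_subtype_eq_of_support_subset (Function.support_subset_iff'.2 hF)).symm
  have proj_eq_zero : ∀ t ∉ S, ∀ v, (eigSpace T t).starProjection v = 0 := fun t ht =>
    starProjection_eq_zero_of_not_hasEigenvalue ht
  have aemeasurable_proj : ∀ t : ℝ,
      AEMeasurable (fun x => ‖(eigSpace T t).starProjection (ψ x)‖ₑ ^ 2) ν := fun t =>
    ((ContinuousLinearMap.continuous _).comp_aestronglyMeasurable hψ).enorm.pow_const 2
  rw [tsum_eq_tsum_subtype _ fun t ht => by simp [proj_eq_zero t ht]]
  simp_rw [enorm_sq_spectralFun hT hM]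
  rw [lintegral_congr fun x => tsum_eq_tsum_subtype _ fun t ht => by simp [proj_eq_zero t ht],
    lintegral_tsum fun t : S => (aemeasurable_proj t).const_mul _]
  exact tsum_congr fun t => lintegral_const_mul'' _ (aemeasurable_proj t)

end RandomVectors

section FeatureMaps

variable {X : Type*} [MeasurableSpace X] {ν : Measure X}
  {H : Type*} [NormedAddCommGroup H] [InnerProductSpace ℝ H]
  {A : H →L[ℝ] Lp ℝ 2 ν} {φ : X → H}

/-- `φ` represents the point evaluations of `A`, almost everywhere for each `f`:
`(A f)(x) = ⟨f, φ_x⟩`. -/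
def IsFeatureMap (A : H →L[ℝ] Lp ℝ 2 ν) (φ : X → H) : Prop :=
  ∀ f : H, (A f : X → ℝ) =ᵐ[ν] fun x => ⟪f, φ x⟫_ℝ

theorem IsFeatureMap.lintegral_enorm_sq_inner (hφ : IsFeatureMap A φ) (f : H) :
    ∫⁻ x, ‖⟪f, φ x⟫_ℝ‖ₑ ^ 2 ∂ν = ENNReal.ofReal (‖A f‖ ^ 2) := by
  have inner_ae_eq : (fun x => ‖⟪f, φ x⟫_ℝ‖ₑ ^ 2) =ᵐ[ν] fun x => ‖A f x‖ₑ ^ 2 :=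
    (hφ f).mono fun x hx => by simp only [hx]
  rw [lintegral_congr_ae inner_ae_eq, lintegral_enorm_sq_eq_ofReal_integral (Lp.memLp (A f)),
    ← real_inner_self_eq_norm_sq, L2.inner_def]
  simp only [real_inner_self_eq_norm_sq]

variable [CompleteSpace H] [TopologicalSpace.SeparableSpace H]

theorem IsFeatureMap.aestronglyMeasurable (hφ : IsFeatureMap A φ) : AEStronglyMeasurable φ ν :=
  aestronglyMeasurable_of_inner fun f => (Lp.aestronglyMeasurable (A f)).congr (hφ f)

theorem IsFeatureMap.lintegral_enorm_sq_starProjection_le (hφ : IsFeatureMap A φ) (t : ℝ) :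
    ∫⁻ x, ‖(eigSpace (normalOp A) t).starProjection (φ x)‖ₑ ^ 2 ∂ν
      ≤ (Cardinal.toENat (Module.rank ℝ (eigSpace (normalOp A) t)) : ℝ≥0∞)
        * ENNReal.ofReal t := by
  obtain ⟨w, b, -⟩ := exists_hilbertBasis ℝ (eigSpace (normalOp A) t)
  have lintegral_basis : ∀ i, ∫⁻ x, ‖⟪(b i : H), φ x⟫_ℝ‖ₑ ^ 2 ∂ν = ENNReal.ofReal t := by
    intro i
    have norm_basis : ‖(b i : H)‖ = 1 := b.orthonormal.1 i
    rw [hφ.lintegral_enorm_sq_inner, norm_sq_apply_of_mem_eigSpace_normalOp (b i).2, norm_basis,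
      one_pow, mul_one]
  have card_le_rank : ENat.card w
      ≤ Cardinal.toENat (Module.rank ℝ (eigSpace (normalOp A) t)) :=
    OrderHom.mono (β := ℕ∞) Cardinal.toENat b.orthonormal.linearIndependent.cardinal_le_rank
  rw [lintegral_enorm_sq_starProjection _ b hφ.aestronglyMeasurable]
  simp_rw [lintegral_basis]
  rw [ENNReal.tsum_const]
  gcongr

theorem IsFeatureMap.lintegral_enorm_sq_spectralFun_le (hφ : IsFeatureMap A φ) {ev : ℕ → ℝ}
    (hev : IsEigenvalueList (normalOp A) ev) {h : ℝ → ℝ} {M : ℝ}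
    (hM : BoundedOnEigenvalues (normalOp A) h M) :
    ∫⁻ x, ‖spectralFun h (normalOp A) (φ x)‖ₑ ^ 2 ∂ν
      ≤ ∑' j, ENNReal.ofReal (h (ev j) ^ 2 * ev j) := by
  have tsum_fiber : ∀ t, ∑' j : ev ⁻¹' {t}, ENNReal.ofReal (h (ev j) ^ 2 * ev j)
      = ({j | ev j = t}.encard : ℝ≥0∞) * ENNReal.ofReal (h t ^ 2 * t) := by
    intro t
    rw [← ENNReal.tsum_set_const]
    exact tsum_congr fun j => by rw [show ev j = t from j.2]
  rw [lintegral_enorm_sq_spectralFun isSymmetric_normalOp hM hφ.aestronglyMeasurable,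
    ← ENNReal.tsum_fiberwise _ ev]
  refine ENNReal.tsum_le_tsum fun t => ?_
  rw [tsum_fiber]
  refine (mul_le_mul_right (hφ.lintegral_enorm_sq_starProjection_le t) _).trans ?_
  rcases eq_or_ne t 0 with rfl | ht
  · simp
  · rw [hev t ht, ENNReal.ofReal_mul (sq_nonneg _), mul_left_comm]

end FeatureMaps

section SamplingModel

variable {X : Type*} [MeasurableSpace X] {ρ : Measure (X × ℝ)} [IsFiniteMeasure ρ] {y : X → ℝ}
  {σ : ℝ} {H : Type*} [NormedAddCommGroup H] [NormedSpace ℝ H] {ψ : X → H}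

theorem IsSamplingModel.lintegral_enorm_sq (hmodel : IsSamplingModel ρ y σ) :
    ∀ᵐ x ∂ρ.fst, ∫⁻ u, ‖u‖ₑ ^ 2 ∂(ρ.condKernel x) = ENNReal.ofReal (σ ^ 2 + y x ^ 2) := by
  filter_upwards [hmodel.memLp_two, hmodel.cond_mean, hmodel.cond_variance]
    with x memLp_x mean_x variance_x
  rw [variance_eq_sub memLp_x, mean_x, sub_eq_iff_eq_add] at variance_x
  rw [lintegral_enorm_sq_eq_ofReal_integral memLp_x, ← variance_x]
  simp only [Real.norm_eq_abs, sq_abs, Pi.pow_apply]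

theorem IsSamplingModel.lintegral_enorm_sq_smul (hmodel : IsSamplingModel ρ y σ)
    (hψ : AEStronglyMeasurable ψ ρ.fst) : ∫⁻ z, ‖z.2 • ψ z.1‖ₑ ^ 2 ∂ρ
      = ∫⁻ x, ENNReal.ofReal (σ ^ 2 + y x ^ 2) * ‖ψ x‖ₑ ^ 2 ∂ρ.fst := by
  obtain ⟨g, measurable_g, hg⟩ : AEMeasurable (fun x => ‖ψ x‖ₑ ^ 2) ρ.fst := hψ.enorm.pow_const 2
  have integrand_eq : (fun z => ‖z.2 • ψ z.1‖ₑ ^ 2) =ᵐ[ρ] fun z => ‖z.2‖ₑ ^ 2 * g z.1 := by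
    filter_upwards [ae_of_ae_map measurable_fst.aemeasurable hg] with z hz
    rw [enorm_smul, mul_pow, hz]
  rw [lintegral_congr_ae integrand_eq, ← Measure.lintegral_condKernel (by fun_prop)]
  refine lintegral_congr_ae ?_
  filter_upwards [hmodel.lintegral_enorm_sq, hg] with x second_moment_x hgx
  rw [lintegral_mul_const _ (by fun_prop), second_moment_x, hgx]

theorem IsSamplingModel.lintegral_enorm_sq_smul_le (hmodel : IsSamplingModel ρ y σ) {L : ℝ}
    (hL : ∀ᵐ x ∂ρ.fst, σ ^ 2 + y x ^ 2 ≤ L) (hψ : AEStronglyMeasurable ψ ρ.fst) :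
    ∫⁻ z, ‖z.2 • ψ z.1‖ₑ ^ 2 ∂ρ ≤ ENNReal.ofReal L * ∫⁻ x, ‖ψ x‖ₑ ^ 2 ∂ρ.fst := by
  rw [hmodel.lintegral_enorm_sq_smul hψ, ← lintegral_const_mul'' _ (hψ.enorm.pow_const 2)]
  refine lintegral_mono_ae (hL.mono fun x hx => ?_)
  gcongr

theorem IsSamplingModel.memLp_smul (hmodel : IsSamplingModel ρ y σ) {L C : ℝ}
    (hL : ∀ᵐ x ∂ρ.fst, σ ^ 2 + y x ^ 2 ≤ L) (hψ : AEStronglyMeasurable ψ ρ.fst)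
    (hC : ∀ᵐ x ∂ρ.fst, ‖ψ x‖ ≤ C) : MemLp (fun z : X × ℝ => z.2 • ψ z.1) 2 ρ := by
  have aestronglyMeasurable_smul : AEStronglyMeasurable (fun z : X × ℝ => z.2 • ψ z.1) ρ :=
    measurable_snd.aestronglyMeasurable.smul (hψ.comp_measurable measurable_fst)
  have lintegral_ψ_lt_top : ∫⁻ x, ‖ψ x‖ₑ ^ 2 ∂ρ.fst < ∞ :=
    calc ∫⁻ x, ‖ψ x‖ₑ ^ 2 ∂ρ.fst ≤ ∫⁻ _, ENNReal.ofReal C ^ 2 ∂ρ.fst :=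
          lintegral_mono_ae (hC.mono fun x hx => by
            gcongr
            rw [← ofReal_norm]
            exact ENNReal.ofReal_le_ofReal hx)
      _ < ∞ := by
          rw [lintegral_const]
          exact ENNReal.mul_lt_top (ENNReal.pow_lt_top ENNReal.ofReal_lt_top) (measure_lt_top _ _)
  refine ⟨aestronglyMeasurable_smul, ?_⟩
  rw [eLpNorm_lt_top_iff_lintegral_rpow_enorm_lt_top two_ne_zero ENNReal.ofNat_ne_top]
  simp only [ENNReal.toReal_ofNat, ENNReal.rpow_ofNat]
  exact (hmodel.lintegral_enorm_sq_smul_le hL hψ).trans_lt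
    (ENNReal.mul_lt_top ENNReal.ofReal_lt_top lintegral_ψ_lt_top)

end SamplingModel

section FeatureMean

variable {X : Type*} [MeasurableSpace X] {ρ : Measure (X × ℝ)} [IsFiniteMeasure ρ]
  {H : Type*} [NormedAddCommGroup H] [InnerProductSpace ℝ H] [CompleteSpace H]
  {A : H →L[ℝ] Lp ℝ 2 ρ.fst} {φ : X → H}

theorem IsFeatureMap.integral_smul_eq_normalOp (hφ : IsFeatureMap A φ) {f : H} {σ : ℝ}
    (hmodel : IsSamplingModel ρ (A f) σ) (h_int : Integrable (fun z : X × ℝ => z.2 • φ z.1) ρ) :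
    ∫ z, z.2 • φ z.1 ∂ρ = normalOp A f := by
  refine ext_inner_left ℝ fun g => ?_
  rw [← integral_inner h_int, ← Measure.integral_condKernel (h_int.const_inner g),
    inner_normalOp_right, L2.inner_def]
  refine integral_congr_ae ?_
  filter_upwards [hmodel.cond_mean, hφ g] with x mean_x hgx
  simp only [inner_smul_right]
  rw [integral_mul_const, mean_x, hgx]
  rfl

end FeatureMean

section PolynomialDecay

theorem antitone_max_rpow_neg {a b : ℝ} (ha : 0 < a) (hb : 0 ≤ b) :
    Antitone fun x : ℝ => max x a ^ (-b) := fun _ _ hxy =>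
  Real.rpow_le_rpow_of_nonpos (lt_max_of_lt_right ha) (max_le_max_right a hxy) (neg_nonpos.2 hb)

theorem eqOn_max_rpow_Ioc (a b : ℝ) :
    Set.EqOn (fun x : ℝ => max x a ^ (-b)) (fun _ => a ^ (-b)) (Set.Ioc 0 a) :=
  fun x hx => by simp only [max_eq_right hx.2]

theorem eqOn_max_rpow_Ioi (a b : ℝ) :
    Set.EqOn (fun x : ℝ => max x a ^ (-b)) (fun x => x ^ (-b)) (Set.Ioi a) :=
  fun x hx => by simp only [max_eq_left (Set.mem_Ioi.1 hx).le]

theorem integrableOn_Ioc_max_rpow (a b : ℝ) :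
    IntegrableOn (fun x : ℝ => max x a ^ (-b)) (Set.Ioc 0 a) :=
  (integrableOn_congr_fun (eqOn_max_rpow_Ioc a b) measurableSet_Ioc).2
    (integrableOn_const (by simp))

theorem integrableOn_Ioi_max_rpow {a b : ℝ} (ha : 0 < a) (hb : 1 < b) :
    IntegrableOn (fun x : ℝ => max x a ^ (-b)) (Set.Ioi a) :=
  (integrableOn_congr_fun (eqOn_max_rpow_Ioi a b) measurableSet_Ioi).2
    (integrableOn_Ioi_rpow_of_lt (neg_lt_neg hb) ha)

theorem integral_Ioi_zero_max_rpow {a b : ℝ} (ha : 0 < a) (hb : 1 < b) :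
    ∫ x in Set.Ioi 0, max x a ^ (-b) = b / (b - 1) * (a * a ^ (-b)) := by
  have b_sub_one_ne : b - 1 ≠ 0 := (sub_pos.2 hb).ne'
  have neg_b_add_one_ne : -b + 1 ≠ 0 := by linarith
  rw [← Set.Ioc_union_Ioi_eq_Ioi ha.le, setIntegral_union (Set.Ioc_disjoint_Ioi le_rfl)
      measurableSet_Ioi (integrableOn_Ioc_max_rpow a b) (integrableOn_Ioi_max_rpow ha hb),
    setIntegral_congr_fun measurableSet_Ioc (eqOn_max_rpow_Ioc a b),
    setIntegral_congr_fun measurableSet_Ioi (eqOn_max_rpow_Ioi a b),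
    integral_Ioi_rpow_of_lt (neg_lt_neg hb) ha, Real.rpow_add_one ha.ne']
  simp only [setIntegral_const, measureReal_def, Real.volume_Ioc, sub_zero, smul_eq_mul,
    ENNReal.toReal_ofReal ha.le]
  field_simp
  ring

theorem min_one_div_rpow_eq {b u x : ℝ} (hb : 0 < b) (hu : 0 < u) (hx : 0 < x) :
    min 1 (u / x ^ b) = u * max x (u ^ (1 / b)) ^ (-b) := by
  have rpow_inv_rpow : (u ^ (1 / b)) ^ b = u := by
    rw [one_div, Real.rpow_inv_rpow hu.le hb.ne']
  have h_max : max x (u ^ (1 / b)) ^ b = max (x ^ b) u := by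
    rw [(Real.monotoneOn_rpow_Ici_of_exponent_nonneg hb.le).map_max hx.le
      (Real.rpow_nonneg hu.le _), rpow_inv_rpow]
  rw [Real.rpow_neg (hx.le.trans (le_max_left _ _)), h_max, ← div_eq_mul_inv]
  rcases le_total (x ^ b) u with h | h
  · rw [max_eq_right h, div_self hu.ne', min_eq_left ((one_le_div (by positivity)).2 h)]
  · rw [max_eq_left h, min_eq_right ((div_le_one (by positivity)).2 h)]

theorem tsum_ofReal_min_one_div_rpow_le {b u : ℝ} (hb : 1 < b) (hu : 0 < u) :
    ∑' j : ℕ, ENNReal.ofReal (min 1 (u / ((j : ℝ) + 1) ^ b))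
      ≤ ENNReal.ofReal (b / (b - 1) * u ^ (1 / b)) := by
  have hb0 : 0 < b := one_pos.trans hb
  set a := u ^ (1 / b) with ha_def
  have ha : 0 < a := Real.rpow_pos_of_pos hu _
  have u_mul_rpow : u * a ^ (-b) = 1 := by
    rw [Real.rpow_neg ha.le, ha_def, one_div, Real.rpow_inv_rpow hu.le hb0.ne',
      mul_inv_cancel₀ hu.ne']
  have integrableOn_Ioi_zero : IntegrableOn (fun x : ℝ => max x a ^ (-b)) (Set.Ioi 0) :=
    Set.Ioc_union_Ioi_eq_Ioi ha.le ▸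
      (integrableOn_Ioc_max_rpow a b).union (integrableOn_Ioi_max_rpow ha hb)
  have sum_le : ∀ N, ∑ j ∈ Finset.range N, min 1 (u / ((j : ℝ) + 1) ^ b) ≤ b / (b - 1) * a :=
    fun N => calc
      ∑ j ∈ Finset.range N, min 1 (u / ((j : ℝ) + 1) ^ b)
        = u * ∑ j ∈ Finset.range N, max ((j + 1 : ℕ) : ℝ) a ^ (-b) := by
          rw [Finset.mul_sum]
          exact Finset.sum_congr rfl fun j _ => by
            rw [min_one_div_rpow_eq hb0 hu (by positivity), Nat.cast_succ]
      _ ≤ u * ∫ x in Set.Ioi 0, max x a ^ (-b) := by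
          gcongr
          exact ((antitone_max_rpow_neg ha hb0.le).antitoneOn _).sum_range_le_integral
            integrableOn_Ioi_zero fun x _ => by positivity
      _ = b / (b - 1) * a := by
          rw [integral_Ioi_zero_max_rpow ha hb, ← mul_one (b / (b - 1) * a), ← u_mul_rpow]
          ring
  refine ENNReal.tsum_le_of_sum_range_le fun N => ?_
  rw [← ENNReal.ofReal_sum_of_nonneg fun j _ => by positivity]
  exact ENNReal.ofReal_le_ofReal (sum_le N)

theorem sq_mul_le_mul_min {t u a D M : ℝ} (ht : 0 ≤ t) (hD : 0 < D)
    (h_mul : |t * a| ≤ D) (hM : |a| ≤ M) (htu : t ≤ u) : a ^ 2 * t ≤ D * M * min 1 (M / D * u) := by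
  have hM0 : 0 ≤ M := (abs_nonneg a).trans hM
  rw [mul_min_of_nonneg _ _ (by positivity), ← sq_abs]
  refine le_min ?_ ?_
  · calc |a| ^ 2 * t = |t * a| * |a| := by
          rw [abs_mul, abs_of_nonneg ht]
          ring
      _ ≤ D * M * 1 := by
          rw [mul_one]
          gcongr
  · calc |a| ^ 2 * t ≤ M ^ 2 * u := by gcongr
      _ = D * M * (M / D * u) := by field_simp

end PolynomialDecay

section VarianceFactor

variable {X : Type*} [MeasurableSpace X] {ν : Measure X}
  {H : Type*} [NormedAddCommGroup H] [InnerProductSpace ℝ H] [CompleteSpace H]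
  [TopologicalSpace.SeparableSpace H] {A : H →L[ℝ] Lp ℝ 2 ν} {φ : X → H}

theorem IsFeatureMap.lintegral_enorm_sq_spectralFun_le_of_decay (hφ : IsFeatureMap A φ)
    {ev : ℕ → ℝ} (hev : IsEigenvalueList (normalOp A) ev) {d b : ℝ} (hd : 0 < d) (hb : 1 < b)
    (hdecay : ∀ j : ℕ, ev j ≤ d / ((j : ℝ) + 1) ^ b) {h : ℝ → ℝ} {D M : ℝ} (hD : 0 < D)
    (hM : 0 < M) (h_mul_le : BoundedOnEigenvalues (normalOp A) (fun t => t * h t) D)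
    (h_le : BoundedOnEigenvalues (normalOp A) h M) :
    ∫⁻ x, ‖spectralFun h (normalOp A) (φ x)‖ₑ ^ 2 ∂ν
      ≤ ENNReal.ofReal (D * M * (b / (b - 1) * (M / D * d) ^ (1 / b))) := by
  have hDM : 0 ≤ D * M := by positivity
  have term_le : ∀ j, h (ev j) ^ 2 * ev j ≤ D * M * min 1 (M / D * d / ((j : ℝ) + 1) ^ b) := by
    intro j
    rcases eq_or_ne (ev j) 0 with h_zero | h_ne
    · rw [h_zero, mul_zero]
      positivity
    · have h_eig := (hev.hasEigenvalue_iff_mem_range h_ne).2 ⟨j, rfl⟩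
      rw [mul_div_assoc]
      exact sq_mul_le_mul_min (nonneg_of_hasEigenvalue_normalOp h_eig) hD (h_mul_le _ h_eig)
        (h_le _ h_eig) (hdecay j)
  calc ∫⁻ x, ‖spectralFun h (normalOp A) (φ x)‖ₑ ^ 2 ∂ν
      ≤ ∑' j, ENNReal.ofReal (h (ev j) ^ 2 * ev j) :=
        hφ.lintegral_enorm_sq_spectralFun_le hev h_le
    _ ≤ ∑' j : ℕ, ENNReal.ofReal (D * M * min 1 (M / D * d / ((j : ℝ) + 1) ^ b)) :=
        ENNReal.tsum_le_tsum fun j => ENNReal.ofReal_le_ofReal (term_le j)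
    _ = ENNReal.ofReal (D * M)
          * ∑' j : ℕ, ENNReal.ofReal (min 1 (M / D * d / ((j : ℝ) + 1) ^ b)) := by
        simp_rw [ENNReal.ofReal_mul hDM, ENNReal.tsum_mul_left]
    _ ≤ ENNReal.ofReal (D * M * (b / (b - 1) * (M / D * d) ^ (1 / b))) := by
        rw [ENNReal.ofReal_mul hDM]
        gcongr
        exact tsum_ofReal_min_one_div_rpow_le hb (by positivity)

end VarianceFactor

section FilterFamilies

variable {H : Type*} [NormedAddCommGroup H] [InnerProductSpace ℝ H] [CompleteSpace H]

theorem IsFilterFamily.exists_boundedOnEigenvalues {T : H →L[ℝ] H} {s : ℝ → ℝ → ℝ} {q : ℝ}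
    (hs : IsFilterFamily T s q) : ∃ E > 0, ∀ l > 0, BoundedOnEigenvalues T (s l) (E / l) := by
  obtain ⟨E, hE, h_param⟩ := hs.bound_param
  refine ⟨E, hE, fun l hl t ht => ?_⟩
  rw [le_div_iff₀' hl, ← abs_of_pos hl, ← abs_mul, abs_of_pos hl]
  exact h_param l hl t (mem_spectrum_of_hasEigenvalue ht)

variable {K : Type*} [NormedAddCommGroup K] [InnerProductSpace ℝ K] [CompleteSpace K]
  {A : H →L[ℝ] K} {s : ℝ → ℝ → ℝ} {q r : ℝ}

theorem boundedOnEigenvalues_normalOp_rpow (hr : 0 ≤ r) :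
    BoundedOnEigenvalues (normalOp A) (fun t => t ^ r) (‖normalOp A‖ ^ r) := by
  intro t ht
  have h_le := abs_le_norm_of_hasEigenvalue ht
  exact (Real.abs_rpow_le_abs_rpow t r).trans (by gcongr)

theorem IsFilterFamily.exists_norm_residual_le (hs : IsFilterFamily (normalOp A) s q)
    (hr : 0 ≤ r) (hrq : r ≤ q) : ∃ C, ∀ R : ℝ, ∀ f ∈ sourceSet (normalOp A) r R, ∀ l > 0,
      ‖spectralFun (s l) (normalOp A) (normalOp A f) - f‖ ≤ C * R * l ^ r := by
  obtain ⟨E, -, hE⟩ := hs.exists_boundedOnEigenvalues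
  obtain ⟨C, hC, h_qual⟩ := hs.qualification r hr hrq
  refine ⟨C, ?_⟩
  rintro R _ ⟨w, hw, rfl⟩ l hl
  have residual_le := norm_spectralFun_apply_sub_le (C := C * l ^ r) isSymmetric_normalOp (hE l hl)
    (boundedOnEigenvalues_normalOp_rpow hr) (by positivity)
    (fun t ht => h_qual l hl t (mem_spectrum_of_hasEigenvalue ht)) w
  calc _ ≤ C * l ^ r * ‖w‖ := residual_le
    _ ≤ C * l ^ r * R := by gcongr
    _ = C * R * l ^ r := by ring

end FilterFamilies

section VarianceOfFilters

variable {X : Type*} [MeasurableSpace X] {ν : Measure X}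
  {H : Type*} [NormedAddCommGroup H] [InnerProductSpace ℝ H] [CompleteSpace H]
  [TopologicalSpace.SeparableSpace H] {A : H →L[ℝ] Lp ℝ 2 ν} {φ : X → H}

theorem IsFeatureMap.exists_lintegral_enorm_sq_filter_le (hφ : IsFeatureMap A φ)
    {s : ℝ → ℝ → ℝ} {q : ℝ} (hs : IsFilterFamily (normalOp A) s q)
    {ev : ℕ → ℝ} (hev : IsEigenvalueList (normalOp A) ev)
    {d b : ℝ} (hd : 0 < d) (hb : 1 < b) (hdecay : ∀ j : ℕ, ev j ≤ d / ((j : ℝ) + 1) ^ b) :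
    ∃ K ≥ 0, ∀ l > 0, ∫⁻ x, ‖spectralFun (s l) (normalOp A) (φ x)‖ₑ ^ 2 ∂ν
      ≤ ENNReal.ofReal (K * l ^ (-(1 + 1 / b))) := by
  obtain ⟨D, hD, h_mul⟩ := hs.bound_mul
  obtain ⟨E, hE, h_param⟩ := hs.exists_boundedOnEigenvalues
  have : 0 < b - 1 := sub_pos.2 hb
  refine ⟨D * E * (b / (b - 1) * (E / D * d) ^ (1 / b)), by positivity, fun l hl => ?_⟩
  have h_le := hφ.lintegral_enorm_sq_spectralFun_le_of_decay hev hd hb hdecay hD (div_pos hE hl)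
    (fun t ht => h_mul l hl t (mem_spectrum_of_hasEigenvalue ht)) (h_param l hl)
  convert h_le using 2
  have rpow_scale : (E / l / D * d) ^ (1 / b) = (E / D * d) ^ (1 / b) * l ^ (-(1 / b)) := by
    rw [Real.rpow_neg hl.le, ← Real.inv_rpow hl.le, ← Real.mul_rpow (by positivity) (by positivity)]
    congr 1
    ring
  rw [rpow_scale, neg_add, Real.rpow_add hl, Real.rpow_neg_one]
  ring

end VarianceOfFilters

section Integration

variable {H : Type*} [NormedAddCommGroup H] [InnerProductSpace ℝ H] [CompleteSpace H]
  {T : H →L[ℝ] H} {h : ℝ → ℝ} {M : ℝ}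
  {Ω : Type*} [MeasurableSpace Ω] {μ : Measure Ω} {Z : Ω → H}

theorem memLp_spectralFun (hT : (T : H →ₗ[ℝ] H).IsSymmetric) (hM : BoundedOnEigenvalues T h M)
    (hZ : MemLp Z 2 μ) : MemLp (fun ω => spectralFun h T (Z ω)) 2 μ :=
  (isBoundedLinearMap_spectralFun hT hM).toContinuousLinearMap.comp_memLp' hZ

theorem integral_spectralFun (hT : (T : H →ₗ[ℝ] H).IsSymmetric) (hM : BoundedOnEigenvalues T h M)
    (hZ : Integrable Z μ) : ∫ ω, spectralFun h T (Z ω) ∂μ = spectralFun h T (∫ ω, Z ω ∂μ) :=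
  (isBoundedLinearMap_spectralFun hT hM).toContinuousLinearMap.integral_comp_comm hZ

end Integration

section Estimator

variable {H : Type*} [NormedAddCommGroup H] [InnerProductSpace ℝ H] [CompleteSpace H]
  {T : H →L[ℝ] H} {X : Type*} {φ : X → H} {s : ℝ → ℝ → ℝ} {l M : ℝ} {n : ℕ}

theorem estimator_eq_empiricalMean (hT : (T : H →ₗ[ℝ] H).IsSymmetric)
    (hM : BoundedOnEigenvalues T (s l) M) (z : Fin n → X × ℝ) :
    estimator T s φ l z = empiricalMean (fun p => spectralFun (s l) T (p.2 • φ p.1)) z := by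
  have h_linear := isBoundedLinearMap_spectralFun hT hM
  rw [estimator, sampleAdjoint, empiricalMean, h_linear.map_smul]
  exact congrArg _ (map_sum h_linear.toContinuousLinearMap _ _)

variable [MeasurableSpace X] {ρ : Measure (X × ℝ)} [IsProbabilityMeasure ρ]

theorem integrable_norm_sq_estimator_sub (hT : (T : H →ₗ[ℝ] H).IsSymmetric)
    (hM : BoundedOnEigenvalues T (s l) M) (hφ : MemLp (fun p : X × ℝ => p.2 • φ p.1) 2 ρ) (a : H) :
    Integrable (fun z : Fin n → X × ℝ => ‖estimator T s φ l z - a‖ ^ 2)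
      (Measure.pi fun _ => ρ) := by
  simp_rw [estimator_eq_empiricalMean hT hM]
  exact ((memLp_empiricalMean (memLp_spectralFun hT hM hφ)).sub
    (memLp_const a)).integrable_norm_pow two_ne_zero

theorem integral_norm_sq_estimator_sub_le (hT : (T : H →ₗ[ℝ] H).IsSymmetric)
    (hM : BoundedOnEigenvalues T (s l) M) (hφ : MemLp (fun p : X × ℝ => p.2 • φ p.1) 2 ρ)
    (hn : n ≠ 0) (a : H) :
    ∫ z : Fin n → X × ℝ, ‖estimator T s φ l z - a‖ ^ 2 ∂(Measure.pi fun _ => ρ)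
      ≤ 1 / n * ∫ p, ‖spectralFun (s l) T (p.2 • φ p.1)‖ ^ 2 ∂ρ
        + ‖spectralFun (s l) T (∫ p, p.2 • φ p.1 ∂ρ) - a‖ ^ 2 := by
  simp_rw [estimator_eq_empiricalMean hT hM]
  rw [← integral_spectralFun hT hM (hφ.integrable one_le_two)]
  exact integral_norm_sq_empiricalMean_sub_le (memLp_spectralFun hT hM hφ) hn a

end Estimator

section Risk

variable {X : Type*} [MeasurableSpace X] {ρ : Measure (X × ℝ)}
  {H : Type*} [NormedAddCommGroup H] [InnerProductSpace ℝ H]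
  {A : H →L[ℝ] Lp ℝ 2 ρ.fst} {φ : X → H} {c σ : ℝ} {fdag : H}

theorem IsFeatureMap.ae_sq_add_sq_le (hφ : IsFeatureMap A φ)
    (hc : ∀ (x : X) (f : H), |⟪f, φ x⟫_ℝ| ≤ c * ‖f‖) (f : H) (σ : ℝ) :
    ∀ᵐ x ∂ρ.fst, σ ^ 2 + A f x ^ 2 ≤ σ ^ 2 + (c * ‖f‖) ^ 2 := by
  filter_upwards [hφ f] with x hx
  rw [hx]
  gcongr 1
  exact sq_le_sq.2 ((hc x f).trans (le_abs_self _))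

variable [CompleteSpace H] [TopologicalSpace.SeparableSpace H]

theorem IsFeatureMap.memLp_smul [IsFiniteMeasure ρ] (hφ : IsFeatureMap A φ)
    (hc : ∀ (x : X) (f : H), |⟪f, φ x⟫_ℝ| ≤ c * ‖f‖) (hmodel : IsSamplingModel ρ (A fdag) σ) :
    MemLp (fun p : X × ℝ => p.2 • φ p.1) 2 ρ :=
  hmodel.memLp_smul (hφ.ae_sq_add_sq_le hc fdag σ) hφ.aestronglyMeasurable
    (ae_of_all _ fun x => norm_le_abs_of_forall_abs_inner_le (hc x))

theorem IsFeatureMap.integral_norm_sq_spectralFun_smul_le [IsFiniteMeasure ρ]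
    (hφ : IsFeatureMap A φ) (hc : ∀ (x : X) (f : H), |⟪f, φ x⟫_ℝ| ≤ c * ‖f‖)
    (hmodel : IsSamplingModel ρ (A fdag) σ) {T : H →L[ℝ] H} (hT : (T : H →ₗ[ℝ] H).IsSymmetric)
    {h : ℝ → ℝ} {M : ℝ} (hM : BoundedOnEigenvalues T h M) {V : ℝ} (hV0 : 0 ≤ V)
    (hV : ∫⁻ x, ‖spectralFun h T (φ x)‖ₑ ^ 2 ∂ρ.fst ≤ ENNReal.ofReal V) :
    ∫ p, ‖spectralFun h T (p.2 • φ p.1)‖ ^ 2 ∂ρ ≤ (σ ^ 2 + (c * ‖fdag‖) ^ 2) * V := by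
  have h_linear := isBoundedLinearMap_spectralFun hT hM
  rw [← ENNReal.ofReal_le_ofReal_iff (by positivity), ENNReal.ofReal_mul (by positivity),
    ← lintegral_enorm_sq_eq_ofReal_integral
      (memLp_spectralFun hT hM (hφ.memLp_smul hc hmodel))]
  simp_rw [h_linear.map_smul]
  refine (hmodel.lintegral_enorm_sq_smul_le (hφ.ae_sq_add_sq_le hc fdag σ)
    (h_linear.continuous.comp_aestronglyMeasurable hφ.aestronglyMeasurable)).trans ?_
  gcongr

theorem IsFeatureMap.exists_risk_le [IsProbabilityMeasure ρ] (hφ : IsFeatureMap A φ)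
    (hc : ∀ (x : X) (f : H), |⟪f, φ x⟫_ℝ| ≤ c * ‖f‖) (hmodel : IsSamplingModel ρ (A fdag) σ)
    {s : ℝ → ℝ → ℝ} {q : ℝ} (hs : IsFilterFamily (normalOp A) s q)
    {r R : ℝ} (hr : 0 ≤ r) (hrq : r ≤ q) (hsource : fdag ∈ sourceSet (normalOp A) r R)
    {ev : ℕ → ℝ} (hev : IsEigenvalueList (normalOp A) ev)
    {d b : ℝ} (hd : 0 < d) (hb : 1 < b) (hdecay : ∀ j : ℕ, ev j ≤ d / ((j : ℝ) + 1) ^ b) :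
    ∃ V C : ℝ, ∀ l > 0, ∀ n : ℕ, n ≠ 0 →
      ∫ z : Fin n → X × ℝ, ‖estimator (normalOp A) s φ l z - fdag‖ ^ 2
        ∂(Measure.pi fun _ => ρ) ≤ V * (1 / n * l ^ (-(1 + 1 / b))) + C * l ^ (2 * r) := by
  obtain ⟨K, hK0, hK⟩ := hφ.exists_lintegral_enorm_sq_filter_le hs hev hd hb hdecay
  obtain ⟨C, bias_le⟩ := hs.exists_norm_residual_le hr hrq
  obtain ⟨E, -, hE⟩ := hs.exists_boundedOnEigenvalues
  have memLp_feature := hφ.memLp_smul hc hmodel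
  set L := σ ^ 2 + (c * ‖fdag‖) ^ 2
  refine ⟨L * K, (C * R) ^ 2, fun l hl n hn => ?_⟩
  have risk_le := integral_norm_sq_estimator_sub_le isSymmetric_normalOp (hE l hl) memLp_feature
    hn fdag
  have variance_le := hφ.integral_norm_sq_spectralFun_smul_le hc hmodel isSymmetric_normalOp
    (hE l hl) (by positivity) (hK l hl)
  rw [hφ.integral_smul_eq_normalOp hmodel (memLp_feature.integrable one_le_two)] at risk_le
  calc _ ≤ _ := risk_le
    _ ≤ 1 / n * (L * (K * l ^ (-(1 + 1 / b)))) + (C * R * l ^ r) ^ 2 := by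
        gcongr
        exact bias_le R fdag hsource l hl
    _ = L * K * (1 / n * l ^ (-(1 + 1 / b))) + (C * R) ^ 2 * l ^ (2 * r) := by
        rw [mul_pow _ (l ^ r), mul_comm 2 r, Real.rpow_mul hl.le, Real.rpow_ofNat]
        ring

end Risk

section Balancing

theorem isTheta_rpow_balanced {κ p : ℝ} {lam : ℕ → ℝ} (hlam_nonneg : ∀ n, 0 ≤ lam n)
    (hlam : lam =Θ[atTop] fun n : ℕ => (1 / (n : ℝ)) ^ (1 / κ)) :
    (fun n => lam n ^ p) =Θ[atTop] fun n : ℕ => (1 / (n : ℝ)) ^ (p / κ) := by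
  have h_rpow := hlam.rpow (r := p) (Eventually.of_forall hlam_nonneg)
    (Eventually.of_forall fun n => by positivity)
  refine h_rpow.trans_eventuallyEq (Eventually.of_forall fun n => ?_)
  simp only
  rw [← Real.rpow_mul (by positivity), one_div_mul_eq_div]

theorem isBigO_risk_balanced {r a : ℝ} (hr : 0 ≤ r) (ha : 0 ≤ a) (V C : ℝ) {lam : ℕ → ℝ}
    (hlam_nonneg : ∀ n, 0 ≤ lam n)
    (hlam : lam =Θ[atTop] fun n : ℕ => (1 / (n : ℝ)) ^ (1 / (2 * r + 1 + a))) :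
    (fun n : ℕ => V * (1 / (n : ℝ) * lam n ^ (-(1 + a))) + C * lam n ^ (2 * r))
      =O[atTop] fun n : ℕ => (1 / (n : ℝ)) ^ (2 * r / (2 * r + 1 + a)) := by
  have isBigO_rpow := fun p : ℝ => (isTheta_rpow_balanced (p := p) hlam_nonneg hlam).isBigO
  have isBigO_variance : (fun n : ℕ => 1 / (n : ℝ) * lam n ^ (-(1 + a)))
      =O[atTop] fun n : ℕ => (1 / (n : ℝ)) ^ (2 * r / (2 * r + 1 + a)) := by
    refine ((isBigO_refl (fun n : ℕ => 1 / (n : ℝ)) atTop).mul (isBigO_rpow _)).congr'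
      EventuallyEq.rfl ?_
    have exponent_eq : 2 * r / (2 * r + 1 + a) = 1 + -(1 + a) / (2 * r + 1 + a) := by
      field_simp
      ring
    filter_upwards [eventually_gt_atTop 0] with n hn
    rw [exponent_eq, Real.rpow_add (by positivity), Real.rpow_one]
  exact (isBigO_variance.const_mul_left V).add ((isBigO_rpow (2 * r)).const_mul_left C)

end Balancing

end SpectralRate

theorem mainTheorem10
    {X : Type*} [MeasurableSpace X]
    {H : Type*} [NormedAddCommGroup H] [InnerProductSpace ℝ H] [CompleteSpace H]
    [TopologicalSpace.SeparableSpace H]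
    -- the law of one observation `(X, Y)`; its first marginal `ρ.fst` is `ν`
    (ρ : Measure (X × ℝ)) [IsProbabilityMeasure ρ]
    -- the operator `A : H → L²(X, ν)`, `(A f)(x) = ⟨f, φ_x⟩`, with bounded point evaluations
    (A : H →L[ℝ] Lp ℝ 2 ρ.fst) (φ : X → H) (c : ℝ)
    (hA : ∀ f : H, (A f : X → ℝ) =ᵐ[ρ.fst] fun x => inner ℝ f (φ x))
    (hc : ∀ (x : X) (f : H), |inner ℝ f (φ x)| ≤ c * ‖f‖)
    -- the sampling model with regression function `A f†`
    (fdag : H) (σ : ℝ) (hmodel : SpectralRate.IsSamplingModel ρ (A fdag) σ)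
    -- the filter functions and their qualification
    (s : ℝ → ℝ → ℝ) (q : ℝ) (hs : SpectralRate.IsFilterFamily (SpectralRate.normalOp A) s q)
    -- the source condition
    (r R : ℝ) (hr : 0 < r) (hrq : r ≤ q) (hR : 0 < R)
    (hsource : fdag ∈ SpectralRate.sourceSet (SpectralRate.normalOp A) r R)
    -- the eigenvalue decay; `ev j` is the eigenvalue number `j + 1`
    (ev : ℕ → ℝ) (hev : SpectralRate.IsEigenvalueList (SpectralRate.normalOp A) ev)
    (d b : ℝ) (hd : 0 < d) (hb : 1 < b) (hdecay : ∀ j : ℕ, ev j ≤ d / ((j : ℝ) + 1) ^ b)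
    -- the choice of the regularization parameter
    (lam : ℕ → ℝ) (hlam_pos : ∀ n, 0 < lam n)
    (hlam : lam =Θ[atTop] fun n : ℕ => (1 / (n : ℝ)) ^ (1 / (2 * r + 1 + 1 / b))) :
    (∀ n : ℕ, Integrable
      (fun z : Fin n → X × ℝ =>
        ‖SpectralRate.estimator (SpectralRate.normalOp A) s φ (lam n) z - fdag‖ ^ 2)
      (Measure.pi fun _ : Fin n => ρ)) ∧
    (fun n : ℕ => ∫ z : Fin n → X × ℝ,
        ‖SpectralRate.estimator (SpectralRate.normalOp A) s φ (lam n) z - fdag‖ ^ 2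
          ∂(Measure.pi fun _ : Fin n => ρ))
      =O[atTop] fun n : ℕ => (1 / (n : ℝ)) ^ (2 * r / (2 * r + 1 + 1 / b)) := by
  have hφ : SpectralRate.IsFeatureMap A φ := hA
  have memLp_feature := hφ.memLp_smul hc hmodel
  obtain ⟨E, -, hE⟩ := hs.exists_boundedOnEigenvalues
  obtain ⟨V, C, risk_le⟩ := hφ.exists_risk_le hc hmodel hs hr.le hrq hsource hev hd hb hdecay
  refine ⟨fun n => SpectralRate.integrable_norm_sq_estimator_sub
    SpectralRate.isSymmetric_normalOp (hE _ (hlam_pos n)) memLp_feature fdag, ?_⟩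
  have b_inv_nonneg : 0 ≤ 1 / b := by positivity
  refine IsBigO.trans (IsBigO.of_bound' ?_)
    (SpectralRate.isBigO_risk_balanced hr.le b_inv_nonneg V C (fun n => (hlam_pos n).le) hlam)
  filter_upwards [eventually_ne_atTop 0] with n hn
  rw [Real.norm_of_nonneg (integral_nonneg fun _ => sq_nonneg _)]
  exact (risk_le (lam n) (hlam_pos n) n hn).trans (Real.le_norm_self _)
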